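/- For $n\ge 1$ let $\|x\|_1=\sum_{i=1}^n|x_i|$ on $\mathbb R^n$ and $B_1^n=\{x\in\mathbb R^n:\|x\|_1\le 1\}$. Let $\gamma_1^n$ be the measure on $\mathbb R^n$ with Lebesgue density $2^{-n}e^{-\|x\|_1}$, and let $\lambda_{B_1^n}$ be the uniform probability measure on $B_1^n$ (normalized restriction of Lebesgue measure), regarded as a measure on $\mathbb R^n$. For a Borel probability measure $\nu$ on $\mathbb R^n$ with the $\ell_1$ metric, the concentration function is $$\alpha_\nu(\varepsilon)=\sup\{1-\nu(A_\varepsilon): A\subset\mathbb R^n\text{ Borel},\ \nu(A)\ge 1/2\},\qquad A_\varepsilon=\{x:\|x-a\|_1\le\varepsilon\text{ for some }a\in A\};$$ write $\alpha_{(B_1^n,\lambda_{B_1^n})}$ for $\alpha_\nu$ with $\nu=\lambda_{B_1^n}$. There are universal constants $a,b,c,K>0$ such that for every $n\ge1$: 1. there is a nondecreasing function $u:[0,\infty)\to[0,\infty)$ with $u(0)=0$ such that the radial map $Ux=\frac{u(\|x\|_1)}{\|x\|_1}x$ (with $U0=0$) is Borel and pushes $\gamma_1^n$ forward to $\lambda_{B_1^n}$,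 and whose (least) Lipschitz constant satisfies $\frac an\le\|u\|_{Lip}\le\frac bn$; 2. for every $\varepsilon>0$, $\ \alpha_{(B_1^n,\lambda_{B_1^n})}(\varepsilon)\le K e^{-c\varepsilon^2 n}$. -/

import Mathlib

open MeasureTheory Set
open scoped NNReal ENNReal

noncomputable section

/-- The closed `ε`-expansion `{x | d(x, a) ≤ ε for some a ∈ A}` of a set `A`. -/
def expansion {X : Type*} [PseudoMetricSpace X] (ε : ℝ) (A : Set X) : Set X :=
  {x | ∃ a ∈ A, dist x a ≤ ε}

/-- The concentration function
`α(ε) = sup {1 - μ(A_ε) : A measurable, μ(A) ≥ 1/2}` of a metric probability space. -/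
def concentrationFunction {X : Type*} [PseudoMetricSpace X] [MeasurableSpace X]
    (μ : Measure X) (ε : ℝ) : ℝ≥0∞ :=
  ⨆ (A : Set X) (_ : MeasurableSet A) (_ : 1 / 2 ≤ μ A), (1 - μ (expansion ε A))

/-- `ℝⁿ` with the norm `‖x‖₁ = ∑ i, |x i|` and the metric induced by it. -/
abbrev EllOne (n : ℕ) : Type := PiLp 1 (fun _ : Fin n => ℝ)

/-- Lebesgue measure on `ℝⁿ`, carried over to `EllOne n` by the identity map. -/
def lebesgueEllOne (n : ℕ) : Measure (EllOne n) :=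
  (volume : Measure (Fin n → ℝ)).map (WithLp.toLp 1)

/-- The exponential measure, with Lebesgue density `2⁻ⁿ exp (-‖x‖₁)`. -/
def expMeasure (n : ℕ) : Measure (EllOne n) :=
  (lebesgueEllOne n).withDensity
    (fun x => ENNReal.ofReal ((2 : ℝ)⁻¹ ^ n * Real.exp (-‖x‖)))

/-- The cross-polytope, i.e. the closed unit ball of the `ℓ₁` norm. -/
def crossPolytope (n : ℕ) : Set (EllOne n) := Metric.closedBall 0 1

/-- The uniform probability measure on the cross-polytope: normalized restriction of
Lebesgue measure, seen as a measure on `ℝⁿ`. -/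
def uniformCrossPolytope (n : ℕ) : Measure (EllOne n) :=
  ((lebesgueEllOne n) (crossPolytope n))⁻¹ • (lebesgueEllOne n).restrict (crossPolytope n)

/-- The radial map `x ↦ (u(‖x‖) / ‖x‖) x` (with value `0` at the origin). -/
def radialMap {n : ℕ} (u : ℝ≥0 → ℝ≥0) (x : EllOne n) : EllOne n :=
  ((u ‖x‖₊ : ℝ) / ‖x‖) • x

end

/-! The exponential measure is transported radially onto the cross-polytope, and its own
concentration is carried along. Write `n = m + 1`. The `ℓ₁` norm has distribution function `F =
erlangCDF m` under the exponential measure and `s ^ n` on `[0, 1]` under the uniform measure. In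
polar coordinates both measures have the same angular part, so the profile must be `F ^ (1/n)`.
Bounding `exp (-t)` below by `exp (-r)` on `[0, r]` gives a lower bound for `F`, which in turn
bounds the derivative of the profile by `L = (n!) ^ (-1/n)` (`deriv_radialProfile_le`). This is also
the slope at `0`, so `L` is the least Lipschitz constant, and `1/n ≤ L ≤ e/n`.

For concentration, the exponential measure is a product of Laplace measures. If `log φ` is
`l`-Lipschitz for `ℓ₁`, then `(∫ φ) (∫ 1/φ) ≤ (1 - l²) ^ (-2n)`; this holds on the line and
tensorizes (`lintegral_mul_lintegral_inv_le`). Taking `φ = exp (l d(·, A))` and applying Markov's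
inequality yields a tail bound `2 exp (4 l² n - l t)`. The radial map is `3L`-Lipschitz, so distance
`ε` in the cross-polytope pulls back to distance at least `ε n / 9`, and `l` is chosen proportional
to `ε`. -/

/-! ### The exponential measure as a product of Laplace measures. -/

/-- The density of the two-sided exponential (Laplace) distribution. -/
noncomputable def laplaceDensity (s : ℝ) : ℝ≥0∞ := ENNReal.ofReal (2⁻¹ * Real.exp (-|s|))

/-- The two-sided exponential (Laplace) distribution on the real line. -/
noncomputable def laplaceMeasure : Measure ℝ := volume.withDensity laplaceDensity

theorem measurable_laplaceDensity : Measurable laplaceDensity := by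
  unfold laplaceDensity; fun_prop

theorem lintegral_exp_mul_laplaceMeasure {l : ℝ} (hl : |l| < 1) :
    ∫⁻ s, ENNReal.ofReal (Real.exp (l * s)) ∂laplaceMeasure = ENNReal.ofReal ((1 - l ^ 2)⁻¹) := by
  obtain ⟨h1, h2⟩ := abs_lt.1 hl
  have hdens : ∀ s, laplaceDensity s * ENNReal.ofReal (Real.exp (l * s)) =
      ENNReal.ofReal (2⁻¹ * Real.exp (l * s - |s|)) := by
    intro s
    rw [laplaceDensity, ← ENNReal.ofReal_mul (by positivity), mul_assoc, ← Real.exp_add]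
    congr 3; ring
  rw [laplaceMeasure, lintegral_withDensity_eq_lintegral_mul _ measurable_laplaceDensity
    (by fun_prop)]
  simp only [Pi.mul_apply, hdens]
  rw [← lintegral_add_compl _ (measurableSet_Iic (a := (0 : ℝ))), compl_Iic,
    setLIntegral_congr_fun (g := fun s => ENNReal.ofReal (2⁻¹ * Real.exp ((l + 1) * s)))
      measurableSet_Iic, setLIntegral_congr_fun (s := Ioi 0)
      (g := fun s => ENNReal.ofReal (2⁻¹ * Real.exp ((l - 1) * s))) measurableSet_Ioi,
    ← ofReal_integral_eq_lintegral_ofReal, ← ofReal_integral_eq_lintegral_ofReal,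
    integral_const_mul, integral_const_mul, integral_exp_mul_Iic (by linarith),
    integral_exp_mul_Ioi (by linarith), ← ENNReal.ofReal_add]
  · congr 1
    have : l + 1 ≠ 0 := by linarith
    have : l - 1 ≠ 0 := by linarith
    have : 1 - l ^ 2 ≠ 0 := by nlinarith
    simp only [mul_zero, Real.exp_zero]
    field_simp
    ring
  · simp only [mul_zero, Real.exp_zero]
    have : 0 < l + 1 := by linarith
    positivity
  · simp only [mul_zero, Real.exp_zero]
    have : 0 < 1 - l := by linarith
    have h : -1 / (l - 1) = 1 / (1 - l) := by rw [← neg_sub 1 l, neg_div_neg_eq]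
    rw [h]; positivity
  · exact (integrableOn_exp_mul_Ioi (by linarith) 0).const_mul _
  · exact Filter.Eventually.of_forall fun s => by positivity
  · exact (integrableOn_exp_mul_Iic (by linarith) 0).const_mul _
  · exact Filter.Eventually.of_forall fun s => by positivity
  · intro s hs
    dsimp only
    rw [abs_of_pos hs]; congr 3; ring
  · intro s hs
    dsimp only
    rw [abs_of_nonpos hs]; congr 3; ring

instance : IsProbabilityMeasure laplaceMeasure where
  measure_univ := by
    simpa using lintegral_exp_mul_laplaceMeasure (l := 0) (by simp)

theorem lintegral_pi_succ {n : ℕ} (μ : Fin (n + 1) → Measure ℝ) [∀ i, SigmaFinite (μ i)]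
    (f : (Fin (n + 1) → ℝ) → ℝ≥0∞) :
    ∫⁻ x, f x ∂Measure.pi μ =
      ∫⁻ p : ℝ × (Fin n → ℝ), f (Fin.cons p.1 p.2)
        ∂(μ 0).prod (Measure.pi fun i : Fin n => μ i.succ) := by
  rw [← (measurePreserving_piFinSuccAbove μ 0).symm.lintegral_comp_emb
    (MeasurableEquiv.measurableEmbedding _)]
  refine lintegral_congr fun p => congrArg f ?_
  simp only [MeasurableEquiv.piFinSuccAbove_symm_apply, Fin.insertNthEquiv, Equiv.coe_fn_mk]
  exact Fin.insertNth_zero' p.1 p.2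

/-- Tonelli's theorem for a product of functions of single coordinates. -/
theorem lintegral_pi_prod {n : ℕ} (μ : Fin n → Measure ℝ) [∀ i, SigmaFinite (μ i)]
    (f : Fin n → ℝ → ℝ≥0∞) (hf : ∀ i, Measurable (f i)) :
    ∫⁻ x, ∏ i, f i (x i) ∂Measure.pi μ = ∏ i, ∫⁻ s, f i s ∂μ i := by
  induction n with
  | zero => simp
  | succ n ih =>
    have hm : Measurable fun x : Fin n → ℝ => ∏ i, f i.succ (x i) :=
      Finset.measurable_prod _ fun i _ => (hf i.succ).comp (measurable_pi_apply i)
    rw [lintegral_pi_succ]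
    simp only [Fin.prod_univ_succ, Fin.cons_zero, Fin.cons_succ]
    rw [lintegral_prod_mul (hf 0).aemeasurable hm.aemeasurable, ih _ _ fun i => hf _]

theorem pi_withDensity {n : ℕ} (w : ℝ → ℝ≥0∞) (hw : Measurable w)
    [SigmaFinite ((volume : Measure ℝ).withDensity w)] :
    Measure.pi (fun _ : Fin n => (volume : Measure ℝ).withDensity w) =
      (volume : Measure (Fin n → ℝ)).withDensity fun x => ∏ i, w (x i) := by
  refine (Measure.pi_eq fun s hs => ?_)
  rw [withDensity_apply _ (MeasurableSet.univ_pi hs), volume_pi, Measure.restrict_pi_pi,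
    lintegral_pi_prod _ _ fun _ => hw]
  exact Finset.prod_congr rfl fun i _ => (withDensity_apply _ (hs i)).symm

theorem measurable_toLp_one (n : ℕ) : Measurable (WithLp.toLp 1 : (Fin n → ℝ) → EllOne n) :=
  (PiLp.continuous_toLp 1 _).measurable

/-- The `ℓ₁` norm is a sum over coordinates, so the density factorizes. -/
theorem expMeasure_eq_map_pi (n : ℕ) :
    expMeasure n = (Measure.pi fun _ : Fin n => laplaceMeasure).map (WithLp.toLp 1) := by
  have : SigmaFinite ((volume : Measure ℝ).withDensity laplaceDensity) :=
    inferInstanceAs (SigmaFinite laplaceMeasure)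
  have hdens (x : Fin n → ℝ) : ∏ i, laplaceDensity (x i) =
      ENNReal.ofReal ((2 : ℝ)⁻¹ ^ n * Real.exp (-‖(WithLp.toLp 1 x : EllOne n)‖)) := by
    simp only [laplaceDensity]
    rw [← ENNReal.ofReal_prod_of_nonneg (fun i _ => by positivity), Finset.prod_mul_distrib,
      ← Real.exp_sum, PiLp.norm_eq_of_nat 1 (by simp)]
    simp
  rw [show (fun _ : Fin n => laplaceMeasure) = fun _ => volume.withDensity laplaceDensity from rfl,
    pi_withDensity _ measurable_laplaceDensity, expMeasure, lebesgueEllOne]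
  ext s hs
  rw [withDensity_apply _ hs, Measure.map_apply (measurable_toLp_one n) hs,
    withDensity_apply _ (measurable_toLp_one n hs),
    setLIntegral_map hs (by fun_prop) (measurable_toLp_one n)]
  simp only [hdens]

instance (n : ℕ) : IsProbabilityMeasure (expMeasure n) := by
  rw [expMeasure_eq_map_pi]
  exact Measure.isProbabilityMeasure_map (measurable_toLp_one n).aemeasurable

/-! ### Concentration of the exponential measure. -/

/-- The ratio `a / b` lies in `[1/E, E]` with `E = exp |d|`, and `t + 1/t` is largest there at the
endpoints. The proof factors the difference explicitly. -/
theorem div_add_div_le_exp_add_exp {a b d : ℝ} (ha : 0 < a) (hb : 0 < b)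
    (hab : a ≤ Real.exp |d| * b) (hba : b ≤ Real.exp |d| * a) :
    a * b⁻¹ + b * a⁻¹ ≤ Real.exp d + Real.exp (-d) := by
  have key : Real.exp d + Real.exp (-d) = Real.exp |d| + (Real.exp |d|)⁻¹ := by
    rcases abs_cases d with ⟨h, -⟩ | ⟨h, -⟩ <;> rw [h, ← Real.exp_neg]
    rw [neg_neg, add_comm]
  rw [key]
  set E := Real.exp |d|
  have hE : 0 < E := Real.exp_pos _
  have h1 : 0 ≤ (E * b - a) * (E * a - b) :=
    mul_nonneg (sub_nonneg.2 hab) (sub_nonneg.2 hba)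
  have h2 : E + E⁻¹ - (a * b⁻¹ + b * a⁻¹) = (E * b - a) * (E * a - b) / (E * (a * b)) := by
    field_simp
    ring
  have : 0 ≤ E + E⁻¹ - (a * b⁻¹ + b * a⁻¹) := by rw [h2]; positivity
  linarith

theorem ennreal_div_add_div_le {a b : ℝ≥0∞} {d : ℝ} (ha : a ≠ 0) (ha' : a ≠ ∞) (hb : b ≠ 0)
    (hb' : b ≠ ∞) (hab : a ≤ ENNReal.ofReal (Real.exp |d|) * b)
    (hba : b ≤ ENNReal.ofReal (Real.exp |d|) * a) :
    a * b⁻¹ + b * a⁻¹ ≤ ENNReal.ofReal (Real.exp d) + ENNReal.ofReal (Real.exp (-d)) := by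
  have pa := ENNReal.toReal_pos ha ha'
  have pb := ENNReal.toReal_pos hb hb'
  rw [← ENNReal.ofReal_toReal ha', ← ENNReal.ofReal_toReal hb'] at hab hba ⊢
  rw [← ENNReal.ofReal_mul (Real.exp_pos _).le, ENNReal.ofReal_le_ofReal_iff (by positivity)]
    at hab hba
  rw [← ENNReal.ofReal_inv_of_pos pa, ← ENNReal.ofReal_inv_of_pos pb,
    ← ENNReal.ofReal_mul pa.le, ← ENNReal.ofReal_mul pb.le,
    ← ENNReal.ofReal_add (by positivity) (by positivity),
    ← ENNReal.ofReal_add (by positivity) (by positivity)]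
  exact ENNReal.ofReal_le_ofReal (div_add_div_le_exp_add_exp pa pb hab hba)

/-- `φ` takes positive finite values and `log φ` is `l`-Lipschitz for the `ℓ₁` distance. -/
structure LogLipschitz {n : ℕ} (l : ℝ) (φ : (Fin n → ℝ) → ℝ≥0∞) : Prop where
  measurable : Measurable φ
  ne_zero : ∀ x, φ x ≠ 0
  ne_top : ∀ x, φ x ≠ ∞
  le_mul : ∀ x y, φ x ≤ ENNReal.ofReal (Real.exp (l * ∑ i, |x i - y i|)) * φ y

/-- Symmetrization over two independent copies: twice the left side is the integral of `φ(x)/φ(y) +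
φ(y)/φ(x)`, which is pointwise at most `2 cosh (l (x - y))`. Hence linear `log φ` is extremal, and
its integrals are Laplace transforms. -/
theorem lintegral_mul_lintegral_inv_le_one_dim {l : ℝ} (hl0 : 0 ≤ l) (hl : l < 1) {φ : ℝ → ℝ≥0∞}
    (hm : Measurable φ) (h0 : ∀ x, φ x ≠ 0) (ht : ∀ x, φ x ≠ ∞)
    (hφ : ∀ x y, φ x ≤ ENNReal.ofReal (Real.exp (l * |x - y|)) * φ y) :
    (∫⁻ s, φ s ∂laplaceMeasure) * ∫⁻ s, (φ s)⁻¹ ∂laplaceMeasure ≤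
      ENNReal.ofReal ((1 - l ^ 2)⁻¹) ^ 2 := by
  have habs : |l| < 1 := by rwa [abs_of_nonneg hl0]
  have hm' : Measurable fun s => (φ s)⁻¹ := hm.inv
  have hprod : ∀ f g : ℝ → ℝ≥0∞, Measurable f → Measurable g →
      (∫⁻ s, f s ∂laplaceMeasure) * ∫⁻ s, g s ∂laplaceMeasure =
        ∫⁻ p : ℝ × ℝ, f p.1 * g p.2 ∂laplaceMeasure.prod laplaceMeasure := fun f g hf hg =>
    (lintegral_prod_mul hf.aemeasurable hg.aemeasurable).symm
  have hsum : (∫⁻ s, φ s ∂laplaceMeasure) * (∫⁻ s, (φ s)⁻¹ ∂laplaceMeasure) +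
      (∫⁻ s, (φ s)⁻¹ ∂laplaceMeasure) * (∫⁻ s, φ s ∂laplaceMeasure) ≤
      (∫⁻ s, ENNReal.ofReal (Real.exp (l * s)) ∂laplaceMeasure) *
        (∫⁻ s, ENNReal.ofReal (Real.exp (-l * s)) ∂laplaceMeasure) +
      (∫⁻ s, ENNReal.ofReal (Real.exp (-l * s)) ∂laplaceMeasure) *
        (∫⁻ s, ENNReal.ofReal (Real.exp (l * s)) ∂laplaceMeasure) := by
    rw [hprod _ _ hm hm', hprod _ _ hm' hm, hprod _ _ (by fun_prop) (by fun_prop),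
      hprod _ _ (by fun_prop) (by fun_prop), ← lintegral_add_left (by fun_prop),
      ← lintegral_add_left (by fun_prop)]
    refine lintegral_mono fun p => ?_
    have h := ennreal_div_add_div_le (d := l * (p.1 - p.2)) (h0 p.1) (ht p.1) (h0 p.2) (ht p.2)
      (by rw [abs_mul, abs_of_nonneg hl0]; exact hφ _ _)
      (by rw [abs_mul, abs_of_nonneg hl0, abs_sub_comm]; exact hφ _ _)
    rw [← ENNReal.ofReal_mul (by positivity), ← ENNReal.ofReal_mul (by positivity),
      ← Real.exp_add, ← Real.exp_add, mul_comm (φ p.1)⁻¹]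
    convert h using 4 <;> ring
  rw [lintegral_exp_mul_laplaceMeasure habs, lintegral_exp_mul_laplaceMeasure (by rwa [abs_neg]),
    neg_sq, mul_comm (∫⁻ s, (φ s)⁻¹ ∂laplaceMeasure), ← two_mul, ← two_mul, ← sq] at hsum
  exact (ENNReal.mul_le_mul_iff_right two_ne_zero ENNReal.ofNat_ne_top).1 hsum

theorem lintegral_ne_zero_of_ne_zero {α : Type*} [MeasurableSpace α] {μ : Measure α} [NeZero μ]
    {f : α → ℝ≥0∞} (hf : Measurable f) (h : ∀ x, f x ≠ 0) : ∫⁻ x, f x ∂μ ≠ 0 := by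
  intro h0
  obtain ⟨x, hx⟩ := ((lintegral_eq_zero_iff hf).1 h0).exists
  exact h x hx

/-- Tensorization: integrating out one coordinate gives a function `g` that is again log-Lipschitz
with the same constant, while the one-dimensional bound replaces the inner integral of `1/φ` by `B /
g`. The induction hypothesis then applies to `g`. -/
theorem lintegral_mul_lintegral_inv_le {n : ℕ} {l : ℝ} (hl0 : 0 ≤ l) (hl : l < 1)
    {φ : (Fin n → ℝ) → ℝ≥0∞} (hφ : LogLipschitz l φ) :
    (∫⁻ x, φ x ∂Measure.pi fun _ => laplaceMeasure) *
      ∫⁻ x, (φ x)⁻¹ ∂Measure.pi (fun _ => laplaceMeasure) ≤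
      (ENNReal.ofReal ((1 - l ^ 2)⁻¹) ^ 2) ^ n := by
  induction n with
  | zero =>
    have hc : φ = fun _ => φ 0 := funext fun x => congrArg φ (Subsingleton.elim _ _)
    rw [hc]
    simp [ENNReal.mul_inv_cancel (hφ.ne_zero _) (hφ.ne_top _)]
  | succ n ih =>
    have hcons : Measurable fun p : ℝ × (Fin n → ℝ) => (Fin.cons p.1 p.2 : Fin (n + 1) → ℝ) := by
      refine measurable_pi_iff.2 fun i => ?_
      refine Fin.cases ?_ (fun j => ?_) i
      · exact measurable_fst
      · exact (measurable_pi_apply j).comp measurable_snd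
    have hm : Measurable fun p : ℝ × (Fin n → ℝ) => φ (Fin.cons p.1 p.2) :=
      hφ.measurable.comp hcons
    have hm' : Measurable fun p : ℝ × (Fin n → ℝ) => (φ (Fin.cons p.1 p.2))⁻¹ := hm.inv
    have hline (x : Fin n → ℝ) : Measurable fun s : ℝ => φ (Fin.cons s x) :=
      hm.comp measurable_prodMk_right
    have hone (x : Fin n → ℝ) := lintegral_mul_lintegral_inv_le_one_dim hl0 hl (hline x)
      (fun _ => hφ.ne_zero _) (fun _ => hφ.ne_top _) fun s t => by
        simpa [Fin.sum_univ_succ] using hφ.le_mul (Fin.cons s x) (Fin.cons t x)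
    set B := ENNReal.ofReal ((1 - l ^ 2)⁻¹) ^ 2 with hB
    set g : (Fin n → ℝ) → ℝ≥0∞ := fun x => ∫⁻ s, φ (Fin.cons s x) ∂laplaceMeasure with hg
    have hg0 (x) : g x ≠ 0 := lintegral_ne_zero_of_ne_zero (hline x) fun _ => hφ.ne_zero _
    have hinv0 (x) : ∫⁻ s, (φ (Fin.cons s x))⁻¹ ∂laplaceMeasure ≠ 0 :=
      lintegral_ne_zero_of_ne_zero (hline x).inv fun _ => ENNReal.inv_ne_zero.2 (hφ.ne_top _)
    have hBt : B ≠ ∞ := by simp [hB]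
    -- Finiteness comes from the one-dimensional bound itself: the other factor is nonzero and the
    -- product is at most `B`.
    have hgt (x) : g x ≠ ∞ := by
      intro h
      have := hone x
      change g x * _ ≤ B at this
      rw [h, ENNReal.top_mul (hinv0 x), top_le_iff] at this
      exact hBt this
    have hgL : LogLipschitz l g := by
      refine ⟨hm.lintegral_prod_left', hg0, hgt, fun x y => ?_⟩
      rw [hg]
      dsimp only
      rw [← lintegral_const_mul _ (hline y)]
      refine lintegral_mono fun s => ?_
      simpa [Fin.sum_univ_succ] using hφ.le_mul (Fin.cons s x) (Fin.cons s y)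
    rw [lintegral_pi_succ, lintegral_pi_succ, lintegral_prod_symm _ hm.aemeasurable,
      lintegral_prod_symm _ hm'.aemeasurable]
    calc (∫⁻ x, g x ∂Measure.pi fun _ => laplaceMeasure) *
          ∫⁻ x, ∫⁻ s, (φ (Fin.cons s x))⁻¹ ∂laplaceMeasure ∂Measure.pi (fun _ => laplaceMeasure)
        ≤ (∫⁻ x, g x ∂Measure.pi fun _ => laplaceMeasure) *
          ∫⁻ x, B * (g x)⁻¹ ∂Measure.pi (fun _ => laplaceMeasure) := by
          gcongr with x
          rw [← div_eq_mul_inv, ENNReal.le_div_iff_mul_le (Or.inl (hg0 x)) (Or.inl (hgt x)),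
            mul_comm]
          exact hone x
      _ = B * ((∫⁻ x, g x ∂Measure.pi fun _ => laplaceMeasure) *
          ∫⁻ x, (g x)⁻¹ ∂Measure.pi (fun _ => laplaceMeasure)) := by
          rw [lintegral_const_mul' _ _ hBt]; ring
      _ ≤ B * B ^ n := by gcongr; exact ih hgL
      _ = B ^ (n + 1) := by ring

/-- The tangent line suffices: `(1 - l²)(1 + 2l²) = 1 + l²(1 - 2l²) ≥ 1`. -/
theorem inv_one_sub_sq_le_exp {l : ℝ} (hl : l ^ 2 ≤ 1 / 2) :
    (1 - l ^ 2)⁻¹ ≤ Real.exp (2 * l ^ 2) := by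
  have h1 : 0 < 1 - l ^ 2 := by linarith
  rw [inv_le_iff_one_le_mul₀ h1]
  have h2 := Real.add_one_le_exp (2 * l ^ 2)
  have h3 := sq_nonneg l
  nlinarith

/-- Concentration of the exponential measure in the `ℓ₁` distance. -/
theorem expMeasure_far_le {n : ℕ} {l t : ℝ} (hl0 : 0 ≤ l) (hl : l ^ 2 ≤ 1 / 2)
    {A : Set (EllOne n)} (hA : 1 / 2 ≤ expMeasure n A) :
    expMeasure n {x | t ≤ Metric.infDist x A} ≤
      ENNReal.ofReal (2 * Real.exp (4 * l ^ 2 * n - l * t)) := by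
  have hl1 : l < 1 := by nlinarith
  set ψ : EllOne n → ℝ≥0∞ := fun x => ENNReal.ofReal (Real.exp (l * Metric.infDist x A)) with hψ
  have hψm : Measurable ψ := by
    have := (Metric.continuous_infDist_pt A).measurable
    fun_prop
  have hψm' : Measurable fun x => (ψ x)⁻¹ := hψm.inv
  have hL : LogLipschitz l (fun x : Fin n → ℝ => ψ (WithLp.toLp 1 x)) := by
    refine ⟨hψm.comp (measurable_toLp_one n), fun x => ?_, fun x => ENNReal.ofReal_ne_top,
      fun x y => ?_⟩
    · simp only [hψ]
      exact (ENNReal.ofReal_pos.2 (Real.exp_pos _)).ne'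
    · rw [hψ]
      dsimp only
      rw [← ENNReal.ofReal_mul (by positivity), ← Real.exp_add]
      refine ENNReal.ofReal_le_ofReal (Real.exp_le_exp.2 ?_)
      have hd : dist (WithLp.toLp 1 x : EllOne n) (WithLp.toLp 1 y) = ∑ i, |x i - y i| := by
        rw [dist_eq_norm, PiLp.norm_eq_of_nat 1 (by simp)]
        simp
      have := Metric.infDist_le_infDist_add_dist (s := A) (x := (WithLp.toLp 1 x : EllOne n))
        (y := WithLp.toLp 1 y)
      rw [hd] at this
      nlinarith
  have hmain := lintegral_mul_lintegral_inv_le hl0 hl1 hL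
  rw [← lintegral_map (μ := Measure.pi fun _ : Fin n => laplaceMeasure) hψm (measurable_toLp_one n),
    ← lintegral_map (μ := Measure.pi fun _ : Fin n => laplaceMeasure) hψm'
      (measurable_toLp_one n), ← expMeasure_eq_map_pi] at hmain
  -- On `A` the distance vanishes and `ψ = 1`, so the integral of `1/ψ` is at least the mass of `A`.
  have hhalf : 1 / 2 ≤ ∫⁻ x, (ψ x)⁻¹ ∂expMeasure n := by
    refine hA.trans ?_
    calc expMeasure n A ≤ expMeasure n {x | 1 ≤ (ψ x)⁻¹} := by
          refine measure_mono fun x hx => ?_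
          simp [hψ, Metric.infDist_zero_of_mem hx]
      _ ≤ ∫⁻ x, (ψ x)⁻¹ ∂expMeasure n := by
          simpa using mul_meas_ge_le_lintegral (μ := expMeasure n) hψm' 1
  have hint : ∫⁻ x, ψ x ∂expMeasure n ≤ ENNReal.ofReal (2 * Real.exp (4 * l ^ 2 * n)) := by
    have h1 : (∫⁻ x, ψ x ∂expMeasure n) * (1 / 2) ≤ ENNReal.ofReal (Real.exp (4 * l ^ 2 * n)) := by
      calc _ ≤ _ := mul_le_mul_right hhalf _
        _ ≤ _ := hmain
        _ ≤ (ENNReal.ofReal (Real.exp (2 * l ^ 2)) ^ 2) ^ n := by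
          gcongr; exact inv_one_sub_sq_le_exp hl
        _ = _ := by
          rw [← pow_mul, ← ENNReal.ofReal_pow (by positivity), ← Real.exp_nat_mul]
          congr 2; push_cast; ring
    rw [one_div, ← div_eq_mul_inv, ENNReal.div_le_iff two_ne_zero ENNReal.ofNat_ne_top] at h1
    rwa [mul_comm 2, ENNReal.ofReal_mul (by positivity), ENNReal.ofReal_ofNat]
  calc expMeasure n {x | t ≤ Metric.infDist x A}
      ≤ expMeasure n {x | ENNReal.ofReal (Real.exp (l * t)) ≤ ψ x} := by
        refine measure_mono fun x hx => ?_
        exact ENNReal.ofReal_le_ofReal (Real.exp_le_exp.2 (mul_le_mul_of_nonneg_left hx hl0))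
    _ ≤ (∫⁻ x, ψ x ∂expMeasure n) / ENNReal.ofReal (Real.exp (l * t)) :=
        meas_ge_le_lintegral_div hψm.aemeasurable
          (ENNReal.ofReal_pos.2 (Real.exp_pos _)).ne' ENNReal.ofReal_ne_top
    _ ≤ ENNReal.ofReal (2 * Real.exp (4 * l ^ 2 * n)) / ENNReal.ofReal (Real.exp (l * t)) := by
        gcongr
    _ = _ := by
        rw [← ENNReal.ofReal_div_of_pos (Real.exp_pos _), Real.exp_sub, mul_div_assoc]

/-! ### The law of the `ℓ₁` norm. -/

open scoped Nat in
/-- The density of the distribution of `‖x‖₁` under the exponential measure on `ℝ^(m+1)`. -/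
noncomputable def erlangDensity (m : ℕ) (r : ℝ) : ℝ := r ^ m * Real.exp (-r) / m !

/-- The distribution function of `‖x‖₁` under the exponential measure on `ℝ^(m+1)`. -/
noncomputable def erlangCDF (m : ℕ) (r : ℝ) : ℝ := ∫ t in (0 : ℝ)..r, erlangDensity m t

theorem continuous_erlangDensity (m : ℕ) : Continuous (erlangDensity m) := by
  unfold erlangDensity; fun_prop

theorem erlangDensity_pos (m : ℕ) {r : ℝ} (hr : 0 < r) : 0 < erlangDensity m r := by
  unfold erlangDensity; positivity

theorem hasDerivAt_erlangCDF (m : ℕ) (r : ℝ) : HasDerivAt (erlangCDF m) (erlangDensity m r) r :=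
  (continuous_erlangDensity m).integral_hasStrictDerivAt 0 r |>.hasDerivAt

theorem continuous_erlangCDF (m : ℕ) : Continuous (erlangCDF m) :=
  continuous_iff_continuousAt.2 fun r => (hasDerivAt_erlangCDF m r).continuousAt

@[simp]
theorem erlangCDF_zero (m : ℕ) : erlangCDF m 0 = 0 := by simp [erlangCDF]

theorem erlangCDF_strictMonoOn (m : ℕ) : StrictMonoOn (erlangCDF m) (Ici 0) := by
  refine strictMonoOn_of_deriv_pos (convex_Ici 0) (continuous_erlangCDF m).continuousOn ?_
  intro r hr
  rw [interior_Ici] at hr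
  rw [(hasDerivAt_erlangCDF m r).deriv]
  exact erlangDensity_pos m hr

theorem erlangCDF_nonneg (m : ℕ) {r : ℝ} (hr : 0 ≤ r) : 0 ≤ erlangCDF m r := by
  simpa using (erlangCDF_strictMonoOn m).monotoneOn self_mem_Ici hr hr

theorem erlangCDF_pos (m : ℕ) {r : ℝ} (hr : 0 < r) : 0 < erlangCDF m r := by
  simpa using erlangCDF_strictMonoOn m self_mem_Ici hr.le hr

theorem erlangDensity_eq (m : ℕ) (r : ℝ) :
    erlangDensity m r = (Real.exp (-r) * r ^ ((m + 1 : ℝ) - 1)) / m.factorial := by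
  rw [add_sub_cancel_right, Real.rpow_natCast, erlangDensity, mul_comm]

theorem integrableOn_erlangDensity (m : ℕ) : IntegrableOn (erlangDensity m) (Ioi 0) := by
  have := (Real.GammaIntegral_convergent (s := m + 1) (by positivity)).div_const (m.factorial : ℝ)
  refine this.congr (Filter.Eventually.of_forall fun r => (erlangDensity_eq m r).symm)

theorem integral_erlangDensity (m : ℕ) : ∫ r in Ioi 0, erlangDensity m r = 1 := by
  simp only [erlangDensity_eq]
  rw [integral_div, ← Real.Gamma_eq_integral (by positivity), Real.Gamma_nat_eq_factorial,
    div_self (by positivity)]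

theorem tendsto_erlangCDF (m : ℕ) : Filter.Tendsto (erlangCDF m) Filter.atTop (nhds 1) := by
  rw [← integral_erlangDensity m]
  exact intervalIntegral_tendsto_integral_Ioi 0 (integrableOn_erlangDensity m) Filter.tendsto_id

theorem erlangCDF_lt_one (m : ℕ) {r : ℝ} (hr : 0 ≤ r) : erlangCDF m r < 1 := by
  refine (erlangCDF_strictMonoOn m hr (by simp; linarith : r + 1 ∈ Ici (0 : ℝ))
    (by linarith)).trans_le ?_
  refine ge_of_tendsto (tendsto_erlangCDF m) ?_
  filter_upwards [Filter.eventually_ge_atTop (r + 1)] with s hs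
  exact (erlangCDF_strictMonoOn m).monotoneOn (by simp; linarith) (by simp; linarith) hs

-- Replace `exp (-t)` by its minimum `exp (-r)` on `[0, r]` and integrate the power.
open scoped Nat in
theorem le_erlangCDF (m : ℕ) {r : ℝ} (hr : 0 ≤ r) :
    r ^ (m + 1) * Real.exp (-r) / (m + 1)! ≤ erlangCDF m r := by
  have h : r ^ (m + 1) * Real.exp (-r) / (m + 1)! =
      ∫ t in (0 : ℝ)..r, t ^ m * (Real.exp (-r) / m !) := by
    rw [intervalIntegral.integral_mul_const, integral_pow, Nat.factorial_succ]
    push_cast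
    field_simp
    simp
  rw [h]
  refine intervalIntegral.integral_mono_on hr (by apply Continuous.intervalIntegrable; fun_prop)
    ((continuous_erlangDensity m).intervalIntegrable _ _) fun t ht => ?_
  have h0 := ht.1
  rw [erlangDensity, mul_div_assoc]
  gcongr
  exact ht.2

/-! ### The radial profile and its Lipschitz bound. -/

/-- The Lipschitz constant of the radial transport in dimension `m + 1`. -/
noncomputable def radialLip (m : ℕ) : ℝ :=
  (((m + 1).factorial : ℝ)⁻¹) ^ (((m + 1 : ℕ) : ℝ)⁻¹)

theorem radialLip_pos (m : ℕ) : 0 < radialLip m := by unfold radialLip; positivity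

theorem radialLip_pow (m : ℕ) : radialLip m ^ (m + 1) = ((m + 1).factorial : ℝ)⁻¹ :=
  Real.rpow_inv_natCast_pow (by positivity) (by simp)

theorem one_div_le_radialLip (m : ℕ) : 1 / ((m + 1 : ℕ) : ℝ) ≤ radialLip m := by
  refine le_of_pow_le_pow_left₀ (Nat.succ_ne_zero m) (radialLip_pos m).le ?_
  rw [radialLip_pow, div_pow, one_pow, one_div]
  gcongr
  exact_mod_cast Nat.factorial_le_pow (m + 1)

/-- With `n = m + 1`, `n ^ n / n!` is a single term of the series of `exp n`. -/
theorem radialLip_le (m : ℕ) : radialLip m ≤ Real.exp 1 / ((m + 1 : ℕ) : ℝ) := by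
  refine le_of_pow_le_pow_left₀ (Nat.succ_ne_zero m) (by positivity) ?_
  have h := Real.pow_div_factorial_le_exp (x := ((m + 1 : ℕ) : ℝ)) (by positivity) (m + 1)
  rw [radialLip_pow, div_pow, ← Real.exp_nat_mul, mul_one, le_div_iff₀ (by positivity)]
  rwa [div_eq_inv_mul] at h

/-- The radial profile of the transport of the exponential measure on `ℝ^(m+1)` to the
uniform measure on the cross-polytope. -/
noncomputable def radialProfile (m : ℕ) (r : ℝ) : ℝ := erlangCDF m r ^ (((m + 1 : ℕ) : ℝ)⁻¹)

theorem continuous_radialProfile (m : ℕ) : Continuous (radialProfile m) :=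
  (continuous_erlangCDF m).rpow_const fun _ => Or.inr (by positivity)

@[simp]
theorem radialProfile_zero (m : ℕ) : radialProfile m 0 = 0 := by
  rw [radialProfile, erlangCDF_zero, Real.zero_rpow (by positivity)]

theorem radialProfile_nonneg (m : ℕ) {r : ℝ} (hr : 0 ≤ r) : 0 ≤ radialProfile m r :=
  Real.rpow_nonneg (erlangCDF_nonneg m hr) _

theorem radialProfile_pow (m : ℕ) {r : ℝ} (hr : 0 ≤ r) :
    radialProfile m r ^ (m + 1) = erlangCDF m r :=
  Real.rpow_inv_natCast_pow (erlangCDF_nonneg m hr) (by simp)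

theorem radialProfile_strictMonoOn (m : ℕ) : StrictMonoOn (radialProfile m) (Ici 0) :=
  fun _ hr _ hs hrs => Real.rpow_lt_rpow (erlangCDF_nonneg m hr)
    (erlangCDF_strictMonoOn m hr hs hrs) (by positivity)

theorem radialProfile_pos (m : ℕ) {r : ℝ} (hr : 0 < r) : 0 < radialProfile m r :=
  Real.rpow_pos_of_pos (erlangCDF_pos m hr) _

theorem radialProfile_lt_one (m : ℕ) {r : ℝ} (hr : 0 ≤ r) : radialProfile m r < 1 :=
  Real.rpow_lt_one (erlangCDF_nonneg m hr) (erlangCDF_lt_one m hr) (by positivity)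

theorem le_radialProfile (m : ℕ) {r : ℝ} (hr : 0 ≤ r) :
    r * Real.exp (-r / ((m + 1 : ℕ) : ℝ)) * radialLip m ≤ radialProfile m r := by
  refine le_of_pow_le_pow_left₀ (Nat.succ_ne_zero m) (radialProfile_nonneg m hr) ?_
  rw [radialProfile_pow m hr, mul_pow, mul_pow, radialLip_pow, ← Real.exp_nat_mul,
    mul_div_cancel₀ _ (by positivity), ← div_eq_mul_inv]
  exact le_erlangCDF m hr

theorem hasDerivAt_radialProfile (m : ℕ) {r : ℝ} (hr : 0 < r) :
    HasDerivAt (radialProfile m)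
      (erlangDensity m r / (((m + 1 : ℕ) : ℝ) * radialProfile m r ^ m)) r := by
  have hF := erlangCDF_pos m hr
  refine ((hasDerivAt_erlangCDF m r).rpow_const (p := ((m + 1 : ℕ) : ℝ)⁻¹)
    (Or.inl hF.ne')).congr_deriv ?_
  rw [Real.rpow_sub_one hF.ne', ← radialProfile, ← radialProfile_pow m hr.le]
  have := (radialProfile_pos m hr).ne'
  field_simp
  ring

/-- The lower bound `le_radialProfile` controls the denominator. The powers of `r` then cancel, and
what remains is `exp (-r) ≤ exp (-r m / (m + 1))`. -/
theorem deriv_radialProfile_le (m : ℕ) {r : ℝ} (hr : 0 < r) :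
    erlangDensity m r / (((m + 1 : ℕ) : ℝ) * radialProfile m r ^ m) ≤ radialLip m := by
  have hv := radialProfile_pos m hr
  have hL := radialLip_pos m
  rw [div_le_iff₀ (by positivity)]
  have h1 : (r * Real.exp (-r / ((m + 1 : ℕ) : ℝ)) * radialLip m) ^ m ≤ radialProfile m r ^ m := by
    gcongr; exact le_radialProfile m hr.le
  have hexp : Real.exp (-r) ≤ Real.exp (-r / ((m + 1 : ℕ) : ℝ)) ^ m := by
    rw [← Real.exp_nat_mul]
    refine Real.exp_le_exp.2 ?_
    have : (m : ℝ) * (-r / ((m + 1 : ℕ) : ℝ)) = -r + r / ((m + 1 : ℕ) : ℝ) := by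
      push_cast; field_simp; ring
    rw [this]
    have : 0 ≤ r / ((m + 1 : ℕ) : ℝ) := by positivity
    linarith
  have hfact : ((m.factorial : ℕ) : ℝ)⁻¹ = ((m + 1 : ℕ) : ℝ) * radialLip m ^ (m + 1) := by
    rw [radialLip_pow, Nat.factorial_succ]; push_cast; field_simp
  calc erlangDensity m r = r ^ m * Real.exp (-r) * (((m + 1 : ℕ) : ℝ) * radialLip m ^ (m + 1)) := by
        rw [erlangDensity, div_eq_mul_inv, hfact]
    _ ≤ r ^ m * Real.exp (-r / ((m + 1 : ℕ) : ℝ)) ^ m *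
          (((m + 1 : ℕ) : ℝ) * radialLip m ^ (m + 1)) := by gcongr
    _ = radialLip m * (((m + 1 : ℕ) : ℝ) *
          (r * Real.exp (-r / ((m + 1 : ℕ) : ℝ)) * radialLip m) ^ m) := by
        rw [mul_pow, mul_pow]; ring
    _ ≤ _ := by gcongr

theorem radialProfile_sub_le (m : ℕ) {r s : ℝ} (hr : 0 ≤ r) (hrs : r ≤ s) :
    radialProfile m s - radialProfile m r ≤ radialLip m * (s - r) := by
  refine (convex_Ici (0 : ℝ)).image_sub_le_mul_sub_of_deriv_le
    (continuous_radialProfile m).continuousOn ?_ ?_ r hr s (hr.trans hrs) hrs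
  · intro t ht
    rw [interior_Ici] at ht
    exact (hasDerivAt_radialProfile m ht).differentiableAt.differentiableWithinAt
  · intro t ht
    rw [interior_Ici] at ht
    rw [(hasDerivAt_radialProfile m ht).deriv]
    exact deriv_radialProfile_le m ht

theorem image_radialProfile (m : ℕ) : radialProfile m '' Ioi 0 = Ioo 0 1 := by
  refine Subset.antisymm ?_ fun s hs => ?_
  · rintro _ ⟨r, hr, rfl⟩
    exact ⟨radialProfile_pos m hr, radialProfile_lt_one m (le_of_lt hr)⟩
  have hlim : Filter.Tendsto (radialProfile m) Filter.atTop (nhds 1) := by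
    have h := (tendsto_erlangCDF m).rpow_const (p := ((m + 1 : ℕ) : ℝ)⁻¹) (Or.inl one_ne_zero)
    rwa [Real.one_rpow] at h
  obtain ⟨R, hR, hR0⟩ := ((hlim.eventually (lt_mem_nhds hs.2)).and
    (Filter.eventually_ge_atTop 0)).exists
  obtain ⟨r, hr, rfl⟩ := intermediate_value_Icc hR0 (continuous_radialProfile m).continuousOn
    (show s ∈ Icc (radialProfile m 0) (radialProfile m R) from
      ⟨by rw [radialProfile_zero]; exact hs.1.le, hR.le⟩)
  refine ⟨r, lt_of_le_of_ne hr.1 ?_, rfl⟩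
  rintro rfl
  simp at hs

/-- Change of variables `s = radialProfile m r`: differentiating `s ^ (m + 1) = F(r)` gives `(m + 1)
s ^ m ds = erlangDensity m r dr`. -/
theorem lintegral_comp_radialProfile (m : ℕ) (g : ℝ → ℝ≥0∞) :
    ∫⁻ r in Ioi 0, ENNReal.ofReal (erlangDensity m r) * g (radialProfile m r) =
      ∫⁻ s in Ioo 0 1, ENNReal.ofReal (((m + 1 : ℕ) : ℝ) * s ^ m) * g s := by
  rw [← image_radialProfile m, lintegral_image_eq_lintegral_abs_deriv_mul measurableSet_Ioi
    (fun r hr => (hasDerivAt_radialProfile m hr).hasDerivWithinAt)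
    ((radialProfile_strictMonoOn m).injOn.mono Ioi_subset_Ici_self)]
  refine setLIntegral_congr_fun measurableSet_Ioi fun r hr => ?_
  have hv := radialProfile_pos m hr
  have hd := erlangDensity_pos m hr
  rw [← mul_assoc, ← ENNReal.ofReal_mul (abs_nonneg _), abs_of_nonneg (by positivity),
    div_mul_cancel₀ _ (by positivity)]

/-! ### Polar coordinates and the transport of measures. -/

/-- Integration in polar coordinates with respect to an additive Haar measure. -/
theorem lintegral_polarCoord_addHaar {E : Type*} [NormedAddCommGroup E] [NormedSpace ℝ E]
    [MeasurableSpace E] [BorelSpace E] [FiniteDimensional ℝ E] [Nontrivial E] (μ : Measure E)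
    [μ.IsAddHaarMeasure] {f : E → ℝ≥0∞} (hf : Measurable f) :
    ∫⁻ x, f x ∂μ = ∫⁻ θ, ∫⁻ r in Ioi (0 : ℝ),
      ENNReal.ofReal (r ^ (Module.finrank ℝ E - 1)) * f (r • (θ : E)) ∂volume ∂μ.toSphere := by
  have hcont : Continuous fun p : Metric.sphere (0 : E) 1 × Ioi (0 : ℝ) =>
      (p.2 : ℝ) • (p.1 : E) := by fun_prop
  calc ∫⁻ x, f x ∂μ = ∫⁻ x : ({0}ᶜ : Set E), f x ∂μ.comap (↑) := by
        rw [lintegral_subtype_comap (measurableSet_singleton _).compl, restrict_compl_singleton]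
    _ = ∫⁻ p, f ((p.2 : ℝ) • (p.1 : E))
          ∂μ.toSphere.prod (.volumeIoiPow (Module.finrank ℝ E - 1)) := by
        rw [← μ.measurePreserving_homeomorphUnitSphereProd.lintegral_comp_emb
          (Homeomorph.measurableEmbedding _)]
        refine lintegral_congr fun x => ?_
        rw [← homeomorphUnitSphereProd_symm_apply_coe, Homeomorph.symm_apply_apply]
    _ = ∫⁻ θ, ∫⁻ r, f ((r : ℝ) • (θ : E)) ∂.volumeIoiPow (Module.finrank ℝ E - 1)
          ∂μ.toSphere := lintegral_prod _ (hf.comp hcont.measurable).aemeasurable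
    _ = _ := by
        refine lintegral_congr fun θ => ?_
        have hm : Measurable fun r : Ioi (0 : ℝ) => f ((r : ℝ) • (θ : E)) :=
          hf.comp (by fun_prop : Continuous fun r : Ioi (0 : ℝ) => (r : ℝ) • (θ : E)).measurable
        rw [Measure.volumeIoiPow, lintegral_withDensity_eq_lintegral_mul _ (by fun_prop) hm]
        exact lintegral_subtype_comap measurableSet_Ioi
          fun r : ℝ => ENNReal.ofReal (r ^ (Module.finrank ℝ E - 1)) * f (r • (θ : E))

instance (n : ℕ) : (lebesgueEllOne n).IsAddHaarMeasure :=
  (PiLp.continuousLinearEquiv 1 ℝ fun _ : Fin n => ℝ).symm.isAddHaarMeasure_map volume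

theorem finrank_ellOne (n : ℕ) : Module.finrank ℝ (EllOne n) = n := by
  rw [(WithLp.linearEquiv 1 ℝ (Fin n → ℝ)).finrank_eq, Module.finrank_fin_fun]

instance (n : ℕ) : IsProbabilityMeasure (uniformCrossPolytope n) where
  measure_univ := by
    rw [uniformCrossPolytope, Measure.smul_apply, Measure.restrict_apply_univ, smul_eq_mul]
    refine ENNReal.inv_mul_cancel ?_ ?_
    · exact (Metric.measure_closedBall_pos _ _ one_pos).ne'
    · exact measure_closedBall_lt_top.ne

theorem measurable_radialMap {n : ℕ} {u : ℝ≥0 → ℝ≥0} (hu : Continuous u) :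
    Measurable (radialMap (n := n) u) := by
  unfold radialMap
  have : Measurable fun x : EllOne n => (u ‖x‖₊ : ℝ) :=
    (NNReal.continuous_coe.comp (hu.comp continuous_nnnorm)).measurable
  fun_prop

theorem radialMap_smul {n : ℕ} (u : ℝ≥0 → ℝ≥0) {r : ℝ} (hr : 0 < r) {θ : EllOne n}
    (hθ : ‖θ‖ = 1) : radialMap u (r • θ) = (u r.toNNReal : ℝ) • θ := by
  have hn : ‖r • θ‖ = r := by rw [norm_smul, hθ, mul_one, Real.norm_of_nonneg hr.le]
  have hn' : ‖r • θ‖₊ = r.toNNReal := by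
    ext; rw [coe_nnnorm, hn, Real.coe_toNNReal _ hr.le]
  rw [radialMap, hn, hn', smul_smul, div_mul_cancel₀ _ hr.ne']

/-- With `ρ(x) = u(‖x‖)/‖x‖ ≤ M`, split `Ux - Uy = ρ(x)(x - y) + (ρ(x) - ρ(y)) y`. The first term
costs `M`; the second costs `2M`, because `(ρ(x) - ρ(y))‖y‖ = ρ(x)(‖y‖ - ‖x‖) + u(‖x‖) - u(‖y‖)`. -/
theorem radialMap_lipschitz {n : ℕ} {u : ℝ≥0 → ℝ≥0} {M : ℝ≥0} (hu : LipschitzWith M u)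
    (hu0 : u 0 = 0) : LipschitzWith (3 * M) (radialMap (n := n) u) := by
  have hb (r : ℝ≥0) : (u r : ℝ) ≤ M * r := by
    have := hu.dist_le_mul r 0
    rw [hu0, NNReal.dist_eq, NNReal.dist_eq] at this
    simpa using this
  refine LipschitzWith.of_dist_le_mul fun x y => ?_
  have hux : (u ‖x‖₊ : ℝ) ≤ M * ‖x‖ := hb ‖x‖₊
  have huxy : |(u ‖x‖₊ : ℝ) - u ‖y‖₊| ≤ M * ‖x - y‖ := by
    have := hu.dist_le_mul ‖x‖₊ ‖y‖₊
    rw [NNReal.dist_eq, NNReal.dist_eq, coe_nnnorm, coe_nnnorm] at this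
    exact this.trans (mul_le_mul_of_nonneg_left (abs_norm_sub_norm_le x y) M.2)
  have hratio : (u ‖x‖₊ : ℝ) / ‖x‖ ≤ M := div_le_of_le_mul₀ (norm_nonneg _) M.2 hux
  have hratio0 : 0 ≤ (u ‖x‖₊ : ℝ) / ‖x‖ := by positivity
  have hM : (0 : ℝ) ≤ M := M.2
  rw [dist_eq_norm, dist_eq_norm]
  have hdecomp : radialMap u x - radialMap u y =
      ((u ‖x‖₊ : ℝ) / ‖x‖) • (x - y) + ((u ‖x‖₊ : ℝ) / ‖x‖ - (u ‖y‖₊ : ℝ) / ‖y‖) • y := by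
    rw [radialMap, radialMap]; module
  have h1 : ‖((u ‖x‖₊ : ℝ) / ‖x‖) • (x - y)‖ ≤ M * ‖x - y‖ := by
    rw [norm_smul, Real.norm_of_nonneg hratio0]
    gcongr
  have h2 : ‖((u ‖x‖₊ : ℝ) / ‖x‖ - (u ‖y‖₊ : ℝ) / ‖y‖) • y‖ ≤ 2 * M * ‖x - y‖ := by
    rw [norm_smul, Real.norm_eq_abs, ← abs_norm y, ← abs_mul, abs_norm]
    have hcancel (z : EllOne n) : (u ‖z‖₊ : ℝ) / ‖z‖ * ‖z‖ = u ‖z‖₊ := by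
      by_cases hz : z = 0
      · simp [hz, hu0]
      · exact div_mul_cancel₀ _ (norm_ne_zero_iff.2 hz)
    have : ((u ‖x‖₊ : ℝ) / ‖x‖ - (u ‖y‖₊ : ℝ) / ‖y‖) * ‖y‖ =
        (u ‖x‖₊ : ℝ) / ‖x‖ * (‖y‖ - ‖x‖) + ((u ‖x‖₊ : ℝ) - u ‖y‖₊) := by
      rw [sub_mul, hcancel y, mul_sub, hcancel x]; ring
    rw [this]
    have h3 : |(u ‖x‖₊ : ℝ) / ‖x‖ * (‖y‖ - ‖x‖)| ≤ M * ‖x - y‖ := by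
      rw [abs_mul, abs_of_nonneg hratio0, abs_sub_comm]
      gcongr
      exact abs_norm_sub_norm_le x y
    linarith [abs_add_le ((u ‖x‖₊ : ℝ) / ‖x‖ * (‖y‖ - ‖x‖)) ((u ‖x‖₊ : ℝ) - u ‖y‖₊)]
  rw [hdecomp]
  push_cast
  linarith [norm_add_le (((u ‖x‖₊ : ℝ) / ‖x‖) • (x - y))
    (((u ‖x‖₊ : ℝ) / ‖x‖ - (u ‖y‖₊ : ℝ) / ‖y‖) • y)]

/-- The radial transport profile as a function on `[0, ∞)`. -/
noncomputable def transportProfile (m : ℕ) (r : ℝ≥0) : ℝ≥0 :=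
  ⟨radialProfile m r, radialProfile_nonneg m r.2⟩

theorem coe_transportProfile (m : ℕ) (r : ℝ≥0) :
    (transportProfile m r : ℝ) = radialProfile m r := rfl

theorem transportProfile_zero (m : ℕ) : transportProfile m 0 = 0 :=
  NNReal.eq (by simp [coe_transportProfile])

theorem transportProfile_mono (m : ℕ) : Monotone (transportProfile m) := fun r s h =>
  (radialProfile_strictMonoOn m).monotoneOn r.2 s.2 h

theorem transportProfile_lipschitz (m : ℕ) :
    LipschitzWith (radialLip m).toNNReal (transportProfile m) := by
  refine LipschitzWith.of_dist_le_mul fun r s => ?_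
  wlog h : r ≤ s generalizing r s
  · rw [dist_comm, dist_comm r s]
    exact this s r (le_of_not_ge h)
  rw [dist_comm, dist_comm r s, NNReal.dist_eq, NNReal.dist_eq,
    Real.coe_toNNReal _ (radialLip_pos m).le,
    abs_of_nonneg (sub_nonneg.2 (NNReal.coe_le_coe.2 (transportProfile_mono m h))),
    abs_of_nonneg (sub_nonneg.2 (NNReal.coe_le_coe.2 h))]
  exact radialProfile_sub_le m r.2 h

/-- The difference quotients from `0` are at least `exp (-r/(m + 1)) * radialLip m`, which tends to
`radialLip m` as `r → 0+`. -/
theorem radialLip_le_of_lipschitz (m : ℕ) {M : ℝ≥0} (hM : LipschitzWith M (transportProfile m)) :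
    radialLip m ≤ M := by
  have hbound : ∀ r : ℝ, 0 < r → Real.exp (-r / ((m + 1 : ℕ) : ℝ)) * radialLip m ≤ M := by
    intro r hr
    have h1 := hM.dist_le_mul r.toNNReal 0
    rw [transportProfile_zero, NNReal.dist_eq, NNReal.dist_eq, coe_transportProfile,
      Real.coe_toNNReal _ hr.le, NNReal.coe_zero, sub_zero, sub_zero, abs_of_pos hr] at h1
    have h2 := (le_radialProfile m hr.le).trans ((le_abs_self _).trans h1)
    rw [mul_assoc, mul_comm] at h2
    exact le_of_mul_le_mul_right h2 hr
  have hlim : Filter.Tendsto (fun r : ℝ => Real.exp (-r / ((m + 1 : ℕ) : ℝ)) * radialLip m)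
      (nhdsWithin 0 (Ioi 0)) (nhds (radialLip m)) := by
    have hc : Continuous fun r : ℝ => Real.exp (-r / ((m + 1 : ℕ) : ℝ)) * radialLip m := by
      fun_prop
    simpa using (hc.tendsto 0).mono_left nhdsWithin_le_nhds
  refine le_of_tendsto hlim ?_
  filter_upwards [self_mem_nhdsWithin] with r hr using hbound r hr

theorem lintegral_map_radialMap (m : ℕ) {f : EllOne (m + 1) → ℝ≥0∞} (hf : Measurable f) :
    ∫⁻ x, f x ∂(expMeasure (m + 1)).map (radialMap (transportProfile m)) =
      ENNReal.ofReal ((2 : ℝ)⁻¹ ^ (m + 1) * (m + 1).factorial) *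
        ∫⁻ θ, ∫⁻ s in Ioo (0 : ℝ) 1, ENNReal.ofReal (s ^ m) * f (s • (θ : EllOne (m + 1)))
          ∂volume ∂(lebesgueEllOne (m + 1)).toSphere := by
  have hU := measurable_radialMap (n := m + 1) (transportProfile_lipschitz m).continuous
  have hfU : Measurable fun x => f (radialMap (transportProfile m) x) := hf.comp hU
  rw [lintegral_map hf hU, expMeasure,
    lintegral_withDensity_eq_lintegral_mul _ (by fun_prop) hfU,
    lintegral_polarCoord_addHaar _ (by fun_prop),
    ← lintegral_const_mul' _ _ ENNReal.ofReal_ne_top]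
  refine lintegral_congr fun θ => ?_
  have hθ : ‖(θ : EllOne (m + 1))‖ = 1 := by simp
  have hdim : Module.finrank ℝ (EllOne (m + 1)) - 1 = m := by
    rw [finrank_ellOne, Nat.add_sub_cancel]
  have hlhs : ∫⁻ r in Ioi (0 : ℝ), ENNReal.ofReal (erlangDensity m r) *
      (ENNReal.ofReal ((2 : ℝ)⁻¹ ^ (m + 1) * m.factorial) *
        f (radialProfile m r • (θ : EllOne (m + 1)))) = _ :=
    lintegral_comp_radialProfile m fun s => ENNReal.ofReal ((2 : ℝ)⁻¹ ^ (m + 1) * m.factorial) *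
        f (s • (θ : EllOne (m + 1)))
  rw [hdim, ← lintegral_const_mul' _ _ ENNReal.ofReal_ne_top]
  trans
  swap
  · refine hlhs.trans (setLIntegral_congr_fun measurableSet_Ioo fun s hs => ?_)
    have := hs.1
    rw [← mul_assoc, ← mul_assoc, ← ENNReal.ofReal_mul (by positivity),
      ← ENNReal.ofReal_mul (by positivity), Nat.factorial_succ]
    congr 2
    push_cast
    ring
  · refine setLIntegral_congr_fun measurableSet_Ioi fun r (hr : 0 < r) => ?_
    have hn : ‖r • (θ : EllOne (m + 1))‖ = r := by
      rw [norm_smul, hθ, mul_one, Real.norm_of_nonneg hr.le]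
    have hp : ((transportProfile m r.toNNReal : ℝ≥0) : ℝ) = radialProfile m r := by
      rw [coe_transportProfile, Real.coe_toNNReal _ hr.le]
    simp only [Pi.mul_apply, hn, radialMap_smul _ hr hθ, hp]
    rw [← mul_assoc, ← mul_assoc, ← ENNReal.ofReal_mul (by positivity),
      ← ENNReal.ofReal_mul (erlangDensity_pos m hr).le, erlangDensity]
    congr 2
    field_simp

theorem lintegral_uniformCrossPolytope (m : ℕ) {f : EllOne (m + 1) → ℝ≥0∞} (hf : Measurable f) :
    ∫⁻ x, f x ∂uniformCrossPolytope (m + 1) =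
      ((lebesgueEllOne (m + 1)) (crossPolytope (m + 1)))⁻¹ *
        ∫⁻ θ, ∫⁻ s in Ioo (0 : ℝ) 1, ENNReal.ofReal (s ^ m) * f (s • (θ : EllOne (m + 1)))
          ∂volume ∂(lebesgueEllOne (m + 1)).toSphere := by
  have hball : MeasurableSet (crossPolytope (m + 1)) := measurableSet_closedBall
  rw [uniformCrossPolytope, lintegral_smul_measure, smul_eq_mul, ← lintegral_indicator hball,
    lintegral_polarCoord_addHaar _ (hf.indicator hball)]
  congr 1
  refine lintegral_congr fun θ => ?_
  have hθ : ‖(θ : EllOne (m + 1))‖ = 1 := by simp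
  have hdim : Module.finrank ℝ (EllOne (m + 1)) - 1 = m := by
    rw [finrank_ellOne, Nat.add_sub_cancel]
  rw [hdim, Measure.restrict_congr_set Ioo_ae_eq_Ioc, ← Ioi_inter_Iic, inter_comm,
    ← Measure.restrict_restrict measurableSet_Iic, ← lintegral_indicator measurableSet_Iic]
  refine setLIntegral_congr_fun measurableSet_Ioi fun r (hr : 0 < r) => ?_
  have hn : ‖r • (θ : EllOne (m + 1))‖ = r := by
    rw [norm_smul, hθ, mul_one, Real.norm_of_nonneg hr.le]
  by_cases h : r ≤ 1
  · rw [indicator_of_mem (show r ∈ Iic (1 : ℝ) from h), indicator_of_mem]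
    rw [crossPolytope, mem_closedBall_zero_iff, hn]; exact h
  · rw [indicator_of_notMem (show r ∉ Iic (1 : ℝ) from h), indicator_of_notMem, mul_zero]
    rw [crossPolytope, mem_closedBall_zero_iff, hn]; exact h

theorem map_radialMap_expMeasure (m : ℕ) :
    (expMeasure (m + 1)).map (radialMap (transportProfile m)) = uniformCrossPolytope (m + 1) := by
  have hU := measurable_radialMap (n := m + 1) (transportProfile_lipschitz m).continuous
  have : IsProbabilityMeasure ((expMeasure (m + 1)).map (radialMap (transportProfile m))) :=
    Measure.isProbabilityMeasure_map hU.aemeasurable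
  -- Both measures equal a constant times the same polar integral. Testing with `1` shows that each
  -- constant is the inverse of the same number, so the volume of the cross-polytope need not be
  -- computed.
  have h1 := lintegral_map_radialMap m (f := fun _ => 1) measurable_const
  have h2 := lintegral_uniformCrossPolytope m (f := fun _ => 1) measurable_const
  simp only [lintegral_one, measure_univ] at h1 h2
  refine Measure.ext_of_lintegral _ fun f hf => ?_
  rw [lintegral_map_radialMap m hf, lintegral_uniformCrossPolytope m hf,
    ENNReal.eq_inv_of_mul_eq_one_left h1.symm, ENNReal.eq_inv_of_mul_eq_one_left h2.symm]

/-! ### Concentration on the cross-polytope. -/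

/-- The cross-polytope has diameter at most `2`, so the expansion of any set meeting it covers it.
This leaves `ε < 2`, where `l = ε / 72` satisfies `l² ≤ 1/2`. -/
theorem concentrationFunction_uniformCrossPolytope_of_two_le {n : ℕ} {ε : ℝ} (hε : 2 ≤ ε) :
    concentrationFunction (uniformCrossPolytope n) ε = 0 := by
  have hball : MeasurableSet (crossPolytope n) := measurableSet_closedBall
  have hfull : uniformCrossPolytope n (crossPolytope n)ᶜ = 0 := by
    rw [uniformCrossPolytope, Measure.smul_apply, Measure.restrict_apply hball.compl]
    simp
  rw [concentrationFunction, ← nonpos_iff_eq_zero]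
  refine iSup_le fun A => iSup_le fun _ => iSup_le fun hA => ?_
  have hne : (A ∩ crossPolytope n).Nonempty := by
    by_contra hcon
    have hsub : A ⊆ (crossPolytope n)ᶜ := fun x hx hx' => hcon ⟨x, hx, hx'⟩
    have h0 := measure_mono_null hsub hfull
    rw [h0] at hA
    simp at hA
  obtain ⟨a, haA, ha⟩ := hne
  have hsub : (crossPolytope n) ⊆ expansion ε A := fun x hx => by
    refine ⟨a, haA, ?_⟩
    rw [crossPolytope, Metric.mem_closedBall] at hx ha
    linarith [dist_triangle_right x a 0]
  have h1 : uniformCrossPolytope n (crossPolytope n) = 1 :=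
    (prob_compl_eq_zero_iff hball).1 hfull
  rw [nonpos_iff_eq_zero, tsub_eq_zero_iff_le]
  exact h1.ge.trans (measure_mono hsub)

theorem concentrationFunction_uniformCrossPolytope_le (m : ℕ) {ε : ℝ} (hε : 0 < ε) :
    concentrationFunction (uniformCrossPolytope (m + 1)) ε ≤
      ENNReal.ofReal (2 * Real.exp (-(1 / 1296) * ε ^ 2 * ((m + 1 : ℕ) : ℝ))) := by
  rcases le_or_gt 2 ε with h2 | h2
  · rw [concentrationFunction_uniformCrossPolytope_of_two_le h2]
    exact zero_le
  refine iSup_le fun A => iSup_le fun hAm => iSup_le fun hA => ?_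
  have hlip := transportProfile_lipschitz m
  have hU := measurable_radialMap (n := m + 1) hlip.continuous
  have hUlip := radialMap_lipschitz (n := m + 1) hlip (transportProfile_zero m)
  set U := radialMap (n := m + 1) (transportProfile m)
  set B := U ⁻¹' A
  set D := {x | ε ≤ Metric.infDist x A} with hD
  have hDm : MeasurableSet D :=
    measurableSet_le measurable_const (Metric.continuous_infDist_pt A).measurable
  have hmap := map_radialMap_expMeasure m
  have hB : 1 / 2 ≤ expMeasure (m + 1) B := by
    rwa [← hmap, Measure.map_apply hU hAm] at hA
  have hne : B.Nonempty := by
    rw [nonempty_iff_ne_empty]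
    intro h
    rw [h] at hB
    simp at hB
  have hAne : A.Nonempty := hne.imp' U fun _ hx => hx
  have hL := radialLip_pos m
  -- The expansion of a Borel set is not known to be measurable; its complement is enlarged to the
  -- measurable set `D`, which can be pulled back through the pushforward.
  have hcompl : (expansion ε A)ᶜ ⊆ D := fun x hx => by
    refine (Metric.le_infDist hAne).2 fun a ha => ?_
    by_contra hcon
    exact hx ⟨a, ha, (not_le.1 hcon).le⟩
  have hpre : U ⁻¹' D ⊆ {x | ε / (3 * radialLip m) ≤ Metric.infDist x B} := fun x hx => by
    refine (Metric.le_infDist hne).2 fun b hb => ?_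
    have h1 : ε ≤ dist (U x) (U b) := le_trans hx (Metric.infDist_le_dist_of_mem hb)
    have h2 := hUlip.dist_le_mul x b
    push_cast at h2
    rw [Real.coe_toNNReal _ hL.le] at h2
    rw [div_le_iff₀ (by positivity), mul_comm]
    exact h1.trans h2
  have hn : (0 : ℝ) < ((m + 1 : ℕ) : ℝ) := by positivity
  calc 1 - uniformCrossPolytope (m + 1) (expansion ε A)
      ≤ uniformCrossPolytope (m + 1) (expansion ε A)ᶜ := by
        rw [tsub_le_iff_left]
        refine (measure_univ (μ := uniformCrossPolytope (m + 1))).ge.trans ?_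
        rw [← union_compl_self (expansion ε A)]
        exact measure_union_le _ _
    _ ≤ uniformCrossPolytope (m + 1) D := measure_mono hcompl
    _ = expMeasure (m + 1) (U ⁻¹' D) := by rw [← hmap, Measure.map_apply hU hDm]
    _ ≤ _ := measure_mono hpre
    -- With `t ≥ ε n / 9`, the choice `l = ε / 72` minimizes `4 l² n - l ε n / 9`, with minimum `-ε²
    -- n / 1296`.
    _ ≤ _ := expMeasure_far_le (l := ε / 72) (by positivity) (by nlinarith) hB
    _ ≤ _ := by
        refine ENNReal.ofReal_le_ofReal ?_
        gcongr
        -- The bound `L n ≤ e ≤ 3`, combined with the factor `3` of the radial map, produces the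
        -- `9`.
        have hLn : radialLip m * ((m + 1 : ℕ) : ℝ) ≤ 3 := by
          have := radialLip_le m
          rw [le_div_iff₀ hn] at this
          linarith [Real.exp_one_lt_d9]
        have ht : ε * ((m + 1 : ℕ) : ℝ) / 9 ≤ ε / (3 * radialLip m) := by
          rw [div_le_div_iff₀ (by norm_num) (by positivity)]
          nlinarith
        nlinarith

theorem mainTheorem6 :
    ∃ a b c K : ℝ, 0 < a ∧ 0 < b ∧ 0 < c ∧ 0 < K ∧ ∀ n : ℕ, 1 ≤ n →
      (∃ u : ℝ≥0 → ℝ≥0, u 0 = 0 ∧ Monotone u ∧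
        Measurable (radialMap (n := n) u) ∧
        (expMeasure n).map (radialMap u) = uniformCrossPolytope n ∧
        ∃ L : ℝ≥0, IsLeast {M : ℝ≥0 | LipschitzWith M u} L ∧
          a / (n : ℝ) ≤ (L : ℝ) ∧ (L : ℝ) ≤ b / (n : ℝ)) ∧
      ∀ ε : ℝ, 0 < ε →
        concentrationFunction (uniformCrossPolytope n) ε
          ≤ ENNReal.ofReal (K * Real.exp (-c * ε ^ 2 * (n : ℝ))) := by
  refine ⟨1, Real.exp 1, 1 / 1296, 2, one_pos, Real.exp_pos 1, by norm_num, two_pos,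
    fun n hn => ?_⟩
  obtain ⟨m, rfl⟩ := Nat.exists_eq_add_of_le' hn
  have hlip := transportProfile_lipschitz m
  refine ⟨⟨transportProfile m, transportProfile_zero m, transportProfile_mono m,
    measurable_radialMap hlip.continuous, map_radialMap_expMeasure m,
    (radialLip m).toNNReal, ⟨hlip, fun M hM => ?_⟩, ?_, ?_⟩,
    fun ε hε => concentrationFunction_uniformCrossPolytope_le m hε⟩
  · exact Real.toNNReal_le_iff_le_coe.2 (radialLip_le_of_lipschitz m hM)
  · rw [Real.coe_toNNReal _ (radialLip_pos m).le]
    exact one_div_le_radialLip m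
  · rw [Real.coe_toNNReal _ (radialLip_pos m).le]
    exact radialLip_le m
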